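/- Let $n\ge 2$ and let $f(\xi,t)=\sum_{i=1}^n a_i(t)\xi^i$, $t\in[0,\infty)$, be a global polynomial solution of degree $n$ of the zero surface tension Stokes flow problem with injection of strength $2\pi$ at the origin. That is, with $D=\{|\xi|<1\}$, $f'=\partial f/\partial\xi$ and $\overline f(w,t)=\overline{f(\overline w,t)}$, for every $t\ge 0$ the polynomial $f(\cdot,t)$ has degree $n$, is univalent on $\overline D$, satisfies $f(0,t)=0$ and $a_1(t)=f'(0,t)>0$, and $$\frac{\partial}{\partial t}\Big[f'(\xi,t)\,\overline f\big(\tfrac1\xi,t\big)\Big]+2\Lambda'(\xi,t)=0,\qquad |\xi|=1,$$ (the $t$-derivative being assumed to exist, one-sided at $t=0$), where $\Lambda(\xi,t)=\chi(f(\xi,t),t)$ for some $\chi(\cdot,t)$ of the form $\chi(z,t)=-\log z+h(z,t)$ with $h(\cdot,t)$ analytic in $f(D,t)$ and $\chi'=\partial\chi/\partial z$ continuous up to the boundary of $f(D,t)$. For $k\ge 0$ set $$C_k(t)=\frac1{2\pi i}\int_{|\xi|=1}\xi^k f'(\xi,t)\,\overline f\big(\tfrac1\xi,t\big)\,d\xi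 .$$ For $k\ge1$ these quantities are conserved; write $C_k=C_k(0)$. Then for $2\le k\le n$, $$\lim_{t\to\infty}\Big[\overline{a_k(t)}\,a_1(t)-C_{k-1}\Big](2t)=-\sum_{j=2}^{n-k+1} j\,\overline{C_{j-1}}\,C_{j+k-2},$$ and $$\lim_{t\to\infty}\Big[a_1(t)-\sqrt{2t+C_0(0)}\Big](2t)^{3/2}=-\frac12\sum_{k=2}^n k\,|C_{k-1}|^2 .$$ -/

import Mathlib

open Filter Topology Polynomial ComplexConjugate

/-- The conjugate function `f̄(w) = conj (f (conj w))` of a polynomial `f`. -/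
def conjFun (p : ℂ[X]) (w : ℂ) : ℂ := conj (p.eval (conj w))

/-- `dχ` is the derivative of a (possibly multi-valued) function `χ` that is analytic in `Ω ∖ {0}`
and satisfies `χ(z) ~ -log z` as `z → 0`: one has `χ = -log + h` with `h` analytic in `Ω`, hence
`dχ = -1/z + h'`, and `dχ` has continuous values up to the boundary of `Ω`. -/
def IsSourcePotentialDeriv (Ω : Set ℂ) (dχ : ℂ → ℂ) : Prop :=
  ContinuousOn dχ (closure Ω \ {0}) ∧
    ∃ h : ℂ → ℂ, DifferentiableOn ℂ h Ω ∧ ∀ z ∈ Ω \ {0}, dχ z = -1 / z + deriv h z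

/-- A global polynomial solution of degree `n` of the zero surface tension Stokes flow problem with
injection of strength `2π` at the origin. For every `t ≥ 0`, `f t` is a polynomial of degree `n`,
univalent on the closed unit disc `D̄`, with `f(0,t) = 0`, `f'(0,t) > 0`, and for `|ξ| = 1`,
`∂/∂t [f'(ξ,t) f̄(1/ξ,t)] + 2 Λ'(ξ,t) = 0`, where `Λ(ξ,t) = χ(f(ξ,t), t)` for some `χ(·,t)` analytic
in `f(D,t) ∖ {0}` with `χ(z,t) ~ -log z` as `z → 0`. Thus `Λ'(ξ,t) = χ'(f(ξ,t),t) f'(ξ,t)`.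
The time derivative is one-sided at `t = 0`. -/
structure IsGlobalStokesSolution (n : ℕ) (f : ℝ → ℂ[X]) : Prop where
  natDegree_eq : ∀ t, 0 ≤ t → (f t).natDegree = n
  eval_zero : ∀ t, 0 ≤ t → (f t).eval 0 = 0
  deriv_zero_im : ∀ t, 0 ≤ t → ((f t).derivative.eval 0).im = 0
  deriv_zero_pos : ∀ t, 0 ≤ t → 0 < ((f t).derivative.eval 0).re
  univalent : ∀ t, 0 ≤ t → Set.InjOn (fun ξ => (f t).eval ξ) (Metric.closedBall (0 : ℂ) 1)
  equation : ∃ dχ : ℝ → ℂ → ℂ,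
    (∀ t, 0 ≤ t →
      IsSourcePotentialDeriv ((fun ξ => (f t).eval ξ) '' Metric.ball (0 : ℂ) 1) (dχ t)) ∧
    ∀ t, 0 ≤ t → ∀ ξ ∈ Metric.sphere (0 : ℂ) 1, ∃ v : ℂ,
      HasDerivWithinAt (fun s : ℝ => (f s).derivative.eval ξ * conjFun (f s) (1 / ξ)) v
        (Set.Ici 0) t ∧
      v + 2 * (dχ t ((f t).eval ξ) * (f t).derivative.eval ξ) = 0

/-- `C_k = (1 / 2πi) ∮_{|ξ| = 1} ξ^k f'(ξ) f̄(1/ξ) dξ`. -/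
noncomputable def stokesC (p : ℂ[X]) (k : ℕ) : ℂ :=
  1 / (2 * Real.pi * Complex.I) *
    ∮ ξ in C(0, 1), ξ ^ k * p.derivative.eval ξ * conjFun p (1 / ξ)

namespace StokesFlow

/-! Integrating the evolution equation against `ξ ^ k` gives dC_k/dt = 0 for 1 ≤ k < n and dC_0/dt =
2, since ξΛ' is analytic in the disc with value -1 at 0 (`stokesC_eq_add`). By residues C_k = ∑ i
a_i conj(a_{i+k}), so the coefficients solve a closed algebraic system (`MomentSystem`).

Univalence enters again through |a_k| ≤ 2^n a_1 (`norm_coeff_le_of_injOn`): p' has no zeros in the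
disc, so its Mahler measure is |a_1|. The area identity 2t + C_0(0) = ∑ i|a_i|² then forces a_1 → ∞,
and downward induction on k bounds a_1 a_k (`exists_bound`). Hence a_1 conj(a_k) → C_{k-1} and a_1²
~ 2t. Substituting these limits into the quadratic remainders of the moment and area identities
gives both expansions. -/

/-! ### Injective polynomials have nonvanishing derivative -/

/-- With q = p - p(z), the sum of 1/(z₀ - r) over the roots r of q is q'(z₀)/q(z₀) = 0. The root z
is simple and injectivity keeps the others at distance ≥ δ from z₀, so the large term 1/(z₀ - z) has
to be balanced by terms of size at most 1/δ. Letting z → z₀ gives a contradiction. -/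
lemma le_natDegree_mul_norm_sub_of_injOn {p : ℂ[X]} {z₀ z : ℂ} {δ : ℝ} (hδ : 0 < δ)
    (hinj : Set.InjOn (fun ξ => p.eval ξ) (Metric.ball z₀ δ)) (hz : z ∈ Metric.ball z₀ δ)
    (hne : z ≠ z₀) (hz' : p.derivative.eval z ≠ 0) (h0 : p.derivative.eval z₀ = 0) :
    δ ≤ p.natDegree * ‖z₀ - z‖ := by
  have hz₀ : z₀ ∈ Metric.ball z₀ δ := Metric.mem_ball_self hδ
  set q : ℂ[X] := p - C (p.eval z) with hq
  have hqd : q.derivative = p.derivative := by simp [hq]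
  have hq0 : q.eval z₀ ≠ 0 := by
    simp only [hq, eval_sub, eval_C, sub_ne_zero]
    exact fun h => hne (hinj hz hz₀ h.symm)
  have hqne : q ≠ 0 := fun h => hq0 (by simp [h])
  have hroot : z ∈ q.roots := by
    rw [mem_roots hqne]; simp [hq]
  have hsum := (IsAlgClosed.splits q).eval_derivative_div_eval_of_ne_zero hq0
  rw [hqd, h0, zero_div] at hsum
  obtain ⟨s, hs⟩ := Multiset.exists_cons_of_mem hroot
  have hzs : z ∉ s := by
    intro hmem
    have h1 : q.rootMultiplicity z ≤ 1 := by
      by_contra! hlt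
      have := (one_lt_rootMultiplicity_iff_isRoot hqne).1 hlt
      rw [hqd] at this
      exact hz' this.2
    rw [← count_roots, hs, Multiset.count_cons_self] at h1
    have := Multiset.count_pos.2 hmem
    omega
  have hfar : ∀ r ∈ s, δ ≤ ‖z₀ - r‖ := by
    intro r hr
    by_contra! hlt
    have hrq : r ∈ q.roots := by rw [hs]; exact Multiset.mem_cons_of_mem hr
    have hr0 : p.eval r = p.eval z := by
      have := (mem_roots hqne).1 hrq
      simpa [hq, IsRoot, sub_eq_zero] using this
    have : r = z := hinj (by rwa [Metric.mem_ball, dist_comm, dist_eq_norm]) hz hr0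
    exact hzs (this ▸ hr)
  rw [hs, Multiset.map_cons, Multiset.sum_cons] at hsum
  have hnorm : ‖1 / (z₀ - z)‖ ≤ p.natDegree * (1 / δ) := by
    rw [eq_neg_of_add_eq_zero_left hsum.symm, norm_neg]
    calc ‖(s.map fun r => 1 / (z₀ - r)).sum‖
        ≤ ((s.map fun r => 1 / (z₀ - r)).map norm).sum := norm_multiset_sum_le _
      _ ≤ ((s.map fun r => 1 / (z₀ - r)).map norm).card • (1 / δ) := by
          apply Multiset.sum_le_card_nsmul
          intro x hx
          simp only [Multiset.map_map, Multiset.mem_map, Function.comp] at hx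
          obtain ⟨r, hr, rfl⟩ := hx
          rw [norm_div, norm_one]
          exact one_div_le_one_div_of_le hδ (hfar r hr)
      _ ≤ p.natDegree * (1 / δ) := by
          rw [nsmul_eq_mul]
          gcongr
          have h1 : q.roots.card ≤ q.natDegree := card_roots' q
          have h2 : q.natDegree = p.natDegree := natDegree_sub_C
          rw [hs, Multiset.card_cons] at h1
          simp only [Multiset.card_map]
          omega
  have hpos : 0 < ‖z₀ - z‖ := norm_pos_iff.2 (sub_ne_zero.2 hne.symm)
  rw [norm_div, norm_one, div_le_iff₀ hpos] at hnorm
  have : p.natDegree * (1 / δ) * ‖z₀ - z‖ = (p.natDegree * ‖z₀ - z‖) / δ := by ring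
  rwa [this, le_div_iff₀ hδ, one_mul] at hnorm

/-- The derivative of a polynomial that is injective near `z₀` does not vanish at `z₀`. -/
lemma derivative_eval_ne_zero_of_injOn_ball {p : ℂ[X]} {z₀ : ℂ} {δ : ℝ} (hδ : 0 < δ)
    (hinj : Set.InjOn (fun ξ => p.eval ξ) (Metric.ball z₀ δ)) : p.derivative.eval z₀ ≠ 0 := by
  intro h0
  have hball : ∀ᶠ z in 𝓝[≠] z₀, z ∈ Metric.ball z₀ δ ∧ z ≠ z₀ :=
    (eventually_nhdsWithin_of_eventually_nhds (Metric.ball_mem_nhds z₀ hδ)).and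
      self_mem_nhdsWithin
  have hd : p.derivative ≠ 0 := by
    intro hd
    obtain ⟨z, hz, hne⟩ := hball.exists
    obtain ⟨c, hc⟩ : ∃ c, p = C c := ⟨_, eq_C_of_derivative_eq_zero hd⟩
    exact hne (hinj hz (Metric.mem_ball_self hδ) (by simp [hc]))
  have hroots : ∀ᶠ z in 𝓝[≠] z₀, p.derivative.eval z ≠ 0 := by
    have hfin : (p.derivative.roots.toFinset : Set ℂ).Finite := Finset.finite_toSet _
    have h2 : ∀ᶠ z in 𝓝[≠] z₀, z ∉ (p.derivative.roots.toFinset : Set ℂ) := by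
      -- z₀ is itself a root of p', so it is removed before taking the complement.
      have := hfin.subset (Set.sdiff_subset (t := {z₀})) |>.isClosed.isOpen_compl.mem_nhds
        (show z₀ ∈ _ by simp)
      filter_upwards [eventually_nhdsWithin_of_eventually_nhds this, self_mem_nhdsWithin]
        with z hz hne hmem
      exact hz ⟨hmem, hne⟩
    filter_upwards [h2] with z hz h
    exact hz (by simpa [hd] using h)
  have hsmall : ∀ᶠ z in 𝓝[≠] z₀, p.natDegree * ‖z₀ - z‖ < δ := by
    apply eventually_nhdsWithin_of_eventually_nhds
    have hc : Continuous fun z : ℂ => p.natDegree * ‖z₀ - z‖ := by fun_prop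
    exact hc.continuousAt.eventually_lt_const (by simpa using hδ)
  obtain ⟨z, ⟨⟨hz, hne⟩, hz'⟩, hlt⟩ := ((hball.and hroots).and hsmall).exists
  exact absurd (le_natDegree_mul_norm_sub_of_injOn hδ hinj hz hne hz' h0) (not_le.2 hlt)

lemma derivative_eval_ne_zero_of_injOn {p : ℂ[X]} {U : Set ℂ} {z : ℂ} (hU : U ∈ 𝓝 z)
    (hinj : Set.InjOn (fun ξ => p.eval ξ) U) : p.derivative.eval z ≠ 0 := by
  obtain ⟨δ, hδ, hsub⟩ := Metric.mem_nhds_iff.1 hU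
  exact derivative_eval_ne_zero_of_injOn_ball hδ (hinj.mono hsub)

/-! ### Coefficient bound from univalence -/

/-- The Mahler measure of a polynomial without zeros in the open unit disc. -/
lemma mahlerMeasure_eq_norm_coeff_zero {p : ℂ[X]} (h : ∀ r ∈ p.roots, 1 ≤ ‖r‖) :
    p.mahlerMeasure = ‖p.coeff 0‖ := by
  rw [mahlerMeasure_eq_leadingCoeff_mul_prod_roots,
    (IsAlgClosed.splits p).coeff_zero_eq_leadingCoeff_mul_prod_roots, norm_mul, norm_mul,
    norm_pow, norm_neg, norm_one, one_pow, one_mul]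
  congr 1
  have : (p.roots.map fun a => max 1 ‖a‖) = p.roots.map norm :=
    Multiset.map_congr rfl fun r hr => max_eq_right (h r hr)
  rw [this]
  exact (map_multiset_prod (normHom : ℂ →*₀ ℝ) p.roots).symm

/-- The coefficients of a polynomial that is univalent on the unit disc are controlled by its
derivative at the origin. -/
lemma norm_coeff_le_of_injOn {p : ℂ[X]}
    (hinj : Set.InjOn (fun ξ => p.eval ξ) (Metric.closedBall (0 : ℂ) 1)) {k : ℕ} (hk : 1 ≤ k) :
    ‖p.coeff k‖ ≤ 2 ^ p.natDegree * ‖p.coeff 1‖ := by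
  obtain ⟨m, rfl⟩ := Nat.exists_eq_add_of_le' hk
  have hroots : ∀ r ∈ p.derivative.roots, 1 ≤ ‖r‖ := by
    intro r hr
    by_contra! hlt
    refine derivative_eval_ne_zero_of_injOn (z := r) ?_ hinj (isRoot_of_mem_roots hr)
    exact Filter.mem_of_superset (Metric.isOpen_ball.mem_nhds (by simpa using hlt))
      Metric.ball_subset_closedBall
  have h1 := norm_coeff_le_choose_mul_mahlerMeasure m p.derivative
  rw [mahlerMeasure_eq_norm_coeff_zero hroots, coeff_derivative, coeff_derivative, norm_mul] at h1
  have h2 : (1 : ℝ) ≤ ‖((m : ℂ) + 1)‖ := by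
    rw [show ((m : ℂ) + 1) = ((m + 1 : ℕ) : ℂ) by push_cast; ring, Complex.norm_natCast]
    push_cast; linarith [(Nat.cast_nonneg m : (0 : ℝ) ≤ m)]
  have h3 : ((p.derivative.natDegree.choose m : ℕ) : ℝ) ≤ 2 ^ p.natDegree := by
    have : p.derivative.natDegree.choose m ≤ 2 ^ p.natDegree :=
      (Nat.choose_le_two_pow _ _).trans
        (Nat.pow_le_pow_right (by norm_num) ((natDegree_derivative_le p).trans (Nat.sub_le _ _)))
    exact_mod_cast this
  calc ‖p.coeff (m + 1)‖ ≤ ‖p.coeff (m + 1)‖ * ‖((m : ℂ) + 1)‖ :=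
        le_mul_of_one_le_right (norm_nonneg _) h2
    _ ≤ _ := h1
    _ ≤ 2 ^ p.natDegree * ‖p.coeff 1‖ := by
        simp only [Nat.cast_zero, zero_add, mul_one]
        gcongr

/-! ### Moments as quadratic sums of coefficients -/

lemma conjFun_eq_eval_map (p : ℂ[X]) (w : ℂ) : conjFun p w = (p.map (starRingEnd ℂ)).eval w := by
  rw [conjFun, eval_map, ← eval₂_id (p := p) (x := conj w), hom_eval₂]
  simp

/-- The polynomial that agrees with `ξ ^ n * p'(ξ) * p̄(1/ξ)` off the origin. -/
noncomputable def boundaryPoly (n : ℕ) (p : ℂ[X]) : ℂ[X] :=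
  derivative p * reflect n (p.map (starRingEnd ℂ))

lemma derivative_mul_conjFun_eq {n : ℕ} {p : ℂ[X]} (hp : p.natDegree ≤ n) {ξ : ℂ} (hξ : ξ ≠ 0) :
    p.derivative.eval ξ * conjFun p (1 / ξ) = (ξ ^ n)⁻¹ * (boundaryPoly n p).eval ξ := by
  let : Invertible ξ⁻¹ := invertibleOfNonzero (inv_ne_zero hξ)
  have h := eval₂_reflect_mul_pow (RingHom.id ℂ) ξ⁻¹ n (p.map (starRingEnd ℂ))
    (natDegree_map_le.trans hp)
  rw [invOf_eq_inv, inv_inv, eval₂_id, eval₂_id] at h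
  rw [conjFun_eq_eval_map, one_div, ← h, boundaryPoly, eval_mul, inv_pow]
  ring

lemma natDegree_boundaryPoly_lt {n : ℕ} (hn : 1 ≤ n) {p : ℂ[X]} (hp : p.natDegree ≤ n) :
    (boundaryPoly n p).natDegree < 2 * n := by
  have h1 : (reflect n (p.map (starRingEnd ℂ))).natDegree ≤ n := by
    rw [natDegree_le_iff_coeff_eq_zero]
    intro N hN
    rw [coeff_reflect, revAt_eq_self_of_lt hN]
    exact coeff_eq_zero_of_natDegree_lt ((natDegree_map_le.trans hp).trans_lt hN)
  have h2 := natDegree_derivative_le p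
  have h3 := natDegree_mul_le (p := derivative p) (q := reflect n (p.map (starRingEnd ℂ)))
  rw [boundaryPoly]
  omega

lemma coeff_boundaryPoly {n k : ℕ} (hk : k < n) (p : ℂ[X]) :
    (boundaryPoly n p).coeff (n - 1 - k) =
      ∑ i ∈ Finset.Icc 1 (n - k), (i : ℂ) * p.coeff i * conj (p.coeff (i + k)) := by
  rw [boundaryPoly, coeff_mul, Finset.Nat.sum_antidiagonal_eq_sum_range_succ_mk,
    show (n - 1 - k).succ = n - k by omega]
  refine Finset.sum_bij (fun i _ => i + 1) ?_ ?_ ?_ ?_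
  · intro i hi
    simp only [Finset.mem_range, Finset.mem_Icc] at *
    omega
  · intro i _ j _ h
    simpa using h
  · intro b hb
    simp only [Finset.mem_Icc] at hb
    exact ⟨b - 1, by simp only [Finset.mem_range]; omega, by omega⟩
  · intro i hi
    rw [Finset.mem_range] at hi
    simp only
    rw [coeff_derivative, coeff_reflect, coeff_map, revAt_le (by omega),
      show n - (n - 1 - k - i) = i + 1 + k by omega]
    push_cast
    ring

/-- Only the monomial of P that produces `ξ ^ (-1)` contributes, namely the one of degree n - 1 - k.
-/
lemma circleIntegral_pow_mul_inv_pow_mul_eval {n k : ℕ} (hk : k < n) (P : ℂ[X]) :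
    (∮ ξ in C(0, 1), ξ ^ k * ((ξ ^ n)⁻¹ * P.eval ξ)) =
      2 * Real.pi * Complex.I * P.coeff (n - 1 - k) := by
  have hcont (P : ℂ[X]) :
      CircleIntegrable (fun ξ : ℂ => ξ ^ k * ((ξ ^ n)⁻¹ * P.eval ξ)) 0 1 := by
    apply ContinuousOn.circleIntegrable zero_le_one
    refine (continuousOn_pow k).mul (ContinuousOn.mul ?_ P.continuous.continuousOn)
    refine (continuousOn_pow n).inv₀ fun ξ hξ => pow_ne_zero _ ?_
    rintro rfl; simp at hξ
  induction P using Polynomial.induction_on' with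
  | add p q hp hq =>
    have : (fun ξ : ℂ => ξ ^ k * ((ξ ^ n)⁻¹ * (p + q).eval ξ)) =
        fun ξ => ξ ^ k * ((ξ ^ n)⁻¹ * p.eval ξ) + ξ ^ k * ((ξ ^ n)⁻¹ * q.eval ξ) := by
      funext ξ; rw [eval_add]; ring
    rw [this, circleIntegral.integral_add (hcont p) (hcont q), hp, hq, coeff_add]
    ring
  | monomial m a =>
    have h : (∮ ξ in C(0, 1), ξ ^ k * ((ξ ^ n)⁻¹ * (monomial m a).eval ξ)) =
        ∮ ξ in C(0, 1), a * (ξ - 0) ^ ((k : ℤ) - n + m) := by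
      refine circleIntegral.integral_congr zero_le_one fun ξ hξ => ?_
      have hξ0 : ξ ≠ 0 := by rintro rfl; simp at hξ
      simp only [sub_zero, eval_monomial]
      rw [zpow_add₀ hξ0, zpow_sub₀ hξ0, zpow_natCast, zpow_natCast, zpow_natCast]
      field_simp
    rw [h, circleIntegral.integral_const_mul, coeff_monomial]
    by_cases hm : m = n - 1 - k
    · rw [if_pos hm, show (k : ℤ) - n + m = -1 by omega]
      simp only [zpow_neg_one]
      rw [circleIntegral.integral_sub_inv_of_mem_ball (by simp)]
      ring
    · rw [if_neg hm, circleIntegral.integral_sub_zpow_of_ne (by omega)]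
      ring

lemma stokesC_eq_coeff {n k : ℕ} (hk : k < n) {p : ℂ[X]} (hp : p.natDegree ≤ n) :
    stokesC p k = (boundaryPoly n p).coeff (n - 1 - k) := by
  have h : (∮ ξ in C(0, 1), ξ ^ k * p.derivative.eval ξ * conjFun p (1 / ξ)) =
      ∮ ξ in C(0, 1), ξ ^ k * ((ξ ^ n)⁻¹ * (boundaryPoly n p).eval ξ) := by
    refine circleIntegral.integral_congr zero_le_one fun ξ hξ => ?_
    have hξ0 : ξ ≠ 0 := by rintro rfl; simp at hξ
    simp only [mul_assoc]
    rw [derivative_mul_conjFun_eq hp hξ0]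
  rw [stokesC, h, circleIntegral_pow_mul_inv_pow_mul_eval hk, ← mul_assoc, one_div,
    inv_mul_cancel₀ Complex.two_pi_I_ne_zero, one_mul]

lemma stokesC_eq_sum {n k : ℕ} (hk : k < n) {p : ℂ[X]} (hp : p.natDegree ≤ n) :
    stokesC p k = ∑ i ∈ Finset.Icc 1 (n - k), (i : ℂ) * p.coeff i * conj (p.coeff (i + k)) := by
  rw [stokesC_eq_coeff hk hp, coeff_boundaryPoly hk]

/-! ### Evolution of the moments -/

/-- A family of polynomials of bounded degree that is differentiable at each point of the unit
circle has differentiable coefficients. -/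
lemma exists_hasDerivWithinAt_coeff {P : ℝ → ℂ[X]} {N : ℕ} (hN : N ≠ 0) {S : Set ℝ} {t : ℝ}
    (hS : UniqueDiffWithinAt ℝ S t) (ht : t ∈ S) (hdeg : ∀ s ∈ S, (P s).natDegree < N) {v : ℂ → ℂ}
    (hv : ∀ ξ ∈ Metric.sphere (0 : ℂ) 1, HasDerivWithinAt (fun s => (P s).eval ξ) (v ξ) S t) :
    ∃ D : ℂ[X], (∀ m, HasDerivWithinAt (fun s => (P s).coeff m) (D.coeff m) S t) ∧
      ∀ ξ ∈ Metric.sphere (0 : ℂ) 1, D.eval ξ = v ξ := by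
  -- The N-th roots of unity are N interpolation nodes on the circle, so each coefficient is a fixed
  -- linear combination of boundary values.
  set ζ : ℂ := Complex.exp (2 * Real.pi * Complex.I / N)
  have hζ : IsPrimitiveRoot ζ N := Complex.isPrimitiveRoot_exp N hN
  have hinj : Set.InjOn (fun j : ℕ => ζ ^ j) (Finset.range N) := by
    intro i hi j hj h
    simp only [Finset.coe_range, Set.mem_Iio] at hi hj
    exact hζ.pow_inj hi hj h
  have hmem (j : ℕ) : ζ ^ j ∈ Metric.sphere (0 : ℂ) 1 := by
    simp [hζ.norm'_eq_one hN]
  have hP : ∀ s ∈ S, P s = Lagrange.interpolate (Finset.range N) (fun j : ℕ => ζ ^ j)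
      (fun j => (P s).eval (ζ ^ j)) := by
    intro s hs
    refine Lagrange.eq_interpolate hinj ?_
    rw [Finset.card_range]
    exact degree_le_natDegree.trans_lt (by exact_mod_cast hdeg s hs)
  set D : ℂ[X] := Lagrange.interpolate (Finset.range N) (fun j : ℕ => ζ ^ j) (fun j => v (ζ ^ j))
  refine ⟨D, fun m => ?_, fun ξ hξ => ?_⟩
  · have h : HasDerivWithinAt (fun s => (Lagrange.interpolate (Finset.range N)
        (fun j : ℕ => ζ ^ j) (fun j => (P s).eval (ζ ^ j))).coeff m) (D.coeff m) S t := by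
      simp only [D, Lagrange.interpolate_apply, finsetSum_coeff, coeff_C_mul]
      exact HasDerivWithinAt.fun_sum fun j _ => (hv _ (hmem j)).mul_const _
    exact h.congr (fun s hs => by rw [← hP s hs]) (by rw [← hP t ht])
  · have h : HasDerivWithinAt (fun s => (Lagrange.interpolate (Finset.range N)
        (fun j : ℕ => ζ ^ j) (fun j => (P s).eval (ζ ^ j))).eval ξ) (D.eval ξ) S t := by
      simp only [D, Lagrange.interpolate_apply, eval_finsetSum, eval_mul, eval_C]
      exact HasDerivWithinAt.fun_sum fun j _ => (hv _ (hmem j)).mul_const _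
    have h' := h.congr (f₁ := fun s => (P s).eval ξ) (fun s hs => by rw [← hP s hs])
      (by rw [← hP t ht])
    exact hS.eq_deriv _ h' (hv ξ hξ)

lemma isOpen_image_ball {p : ℂ[X]}
    (hinj : Set.InjOn (fun ξ => p.eval ξ) (Metric.closedBall (0 : ℂ) 1)) :
    IsOpen ((fun ξ => p.eval ξ) '' Metric.ball (0 : ℂ) 1) := by
  rcases (AnalyticOnNhd.eval_polynomial p).is_constant_or_isOpenMap with ⟨c, hc⟩ | h
  · have : (0 : ℂ) = 1 := hinj (by simp) (by simp) (by simp [hc])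
    exact absurd this zero_ne_one
  · exact h _ Metric.isOpen_ball

/-- The moments of `Λ'`, for `Λ = χ ∘ p`, over the unit circle. -/
lemma circleIntegral_pow_mul_source {p : ℂ[X]} (h0 : p.eval 0 = 0)
    (hinj : Set.InjOn (fun ξ => p.eval ξ) (Metric.closedBall (0 : ℂ) 1)) {dχ : ℂ → ℂ}
    (hχ : IsSourcePotentialDeriv ((fun ξ => p.eval ξ) '' Metric.ball (0 : ℂ) 1) dχ) (k : ℕ) :
    (∮ ξ in C(0, 1), ξ ^ k * (dχ (p.eval ξ) * p.derivative.eval ξ)) =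
      if k = 0 then -(2 * Real.pi * Complex.I) else 0 := by
  obtain ⟨hcont, h, hh, hd⟩ := hχ
  set Ω := (fun ξ => p.eval ξ) '' Metric.ball (0 : ℂ) 1
  have hΩ : IsOpen Ω := isOpen_image_ball hinj
  have hdh : DifferentiableOn ℂ (deriv h) Ω := hh.deriv hΩ
  have hne : ∀ ξ ∈ Metric.closedBall (0 : ℂ) 1, ξ ≠ 0 → p.eval ξ ≠ 0 := fun ξ hξ hξ0 hp =>
    hξ0 (hinj hξ (by simp) (by simp only [hp, h0]))
  have hmaps : ∀ ξ ∈ Metric.closedBall (0 : ℂ) 1, p.eval ξ ∈ closure Ω := by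
    intro ξ hξ
    rw [← closure_ball (0 : ℂ) one_ne_zero] at hξ
    exact image_closure_subset_closure_image p.continuous ⟨ξ, hξ, rfl⟩
  have hballΩ : ∀ ξ ∈ Metric.ball (0 : ℂ) 1, p.eval ξ ∈ Ω := fun ξ hξ => ⟨ξ, hξ, rfl⟩
  obtain ⟨g, hg⟩ : ∃ g : ℂ[X], p = X * g := X_dvd_iff.2 (by rwa [coeff_zero_eq_eval_zero])
  have hpg : ∀ ξ, p.eval ξ = ξ * g.eval ξ := fun ξ => by rw [hg]; simp
  have hg0 : p.derivative.eval 0 = g.eval 0 := by rw [hg]; simp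
  have hgne : ∀ ξ ∈ Metric.ball (0 : ℂ) 1, g.eval ξ ≠ 0 := by
    intro ξ hξ hgξ
    rcases eq_or_ne ξ 0 with rfl | hξ0
    · refine derivative_eval_ne_zero_of_injOn (Metric.closedBall_mem_nhds (0 : ℂ) one_pos) hinj ?_
      rw [hg0, hgξ]
    · exact hne ξ (Metric.ball_subset_closedBall hξ) hξ0 (by rw [hpg, hgξ, mul_zero])
  -- With p = ξg, this is ξΛ' with the pole of -1/p cancelled.
  set I : ℂ → ℂ := fun ξ =>
    -(p.derivative.eval ξ / g.eval ξ) + ξ * (deriv h (p.eval ξ) * p.derivative.eval ξ) with hI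
  have hIdiff : ∀ ξ ∈ Metric.ball (0 : ℂ) 1, DifferentiableAt ℂ I ξ := by
    intro ξ hξ
    have h1 : DifferentiableAt ℂ (deriv h) (p.eval ξ) :=
      hdh.differentiableAt (hΩ.mem_nhds (hballΩ ξ hξ))
    have h2 : DifferentiableAt ℂ (fun ξ => deriv h (p.eval ξ)) ξ :=
      DifferentiableAt.fun_comp' (f := fun ξ => p.eval ξ) ξ h1 p.differentiable.differentiableAt
    exact ((p.derivative.differentiable.differentiableAt.div
      g.differentiable.differentiableAt (hgne ξ hξ)).neg).add
      (differentiableAt_id.mul (h2.mul p.derivative.differentiable.differentiableAt))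
  -- Ψ agrees with `I` inside the disc, hence is analytic there, and is continuous up to the circle
  -- because it is built from `dχ`. The value -1 is forced by p'(0) = g(0).
  set Ψ : ℂ → ℂ := Function.update (fun ξ => ξ * (dχ (p.eval ξ) * p.derivative.eval ξ)) 0 (-1)
    with hΨ
  have hΨI : ∀ ξ ∈ Metric.ball (0 : ℂ) 1, Ψ ξ = I ξ := by
    intro ξ hξ
    rcases eq_or_ne ξ 0 with rfl | hξ0
    · simp [hΨ, hI, hg0, div_self (hgne 0 hξ)]
    · have hp := hne ξ (Metric.ball_subset_closedBall hξ) hξ0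
      have := hgne ξ hξ
      rw [hΨ, Function.update_of_ne hξ0, hd _ ⟨hballΩ ξ hξ, hp⟩, hI]
      simp only
      generalize deriv h (p.eval ξ) = d
      rw [hpg]
      field_simp
  have hΨdiff : ∀ ξ ∈ Metric.ball (0 : ℂ) 1, DifferentiableAt ℂ Ψ ξ := fun ξ hξ =>
    (hIdiff ξ hξ).congr_of_eventuallyEq
      (Filter.eventually_of_mem (Metric.isOpen_ball.mem_nhds hξ) hΨI)
  have hΨcont : ContinuousOn Ψ (Metric.closedBall 0 1) := by
    intro ξ hξ
    rcases eq_or_ne ξ 0 with rfl | hξ0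
    · exact (hΨdiff 0 (by simp)).continuousAt.continuousWithinAt
    · rw [hΨ, continuousWithinAt_update_of_ne hξ0]
      have h1 : ContinuousOn (fun ξ => ξ * (dχ (p.eval ξ) * p.derivative.eval ξ))
          (Metric.closedBall 0 1 \ {0}) := by
        refine continuousOn_id.mul (ContinuousOn.mul ?_ p.derivative.continuous.continuousOn)
        exact hcont.comp p.continuous.continuousOn
          fun z hz => ⟨hmaps z hz.1, hne z hz.1 hz.2⟩
      refine (h1 ξ ⟨hξ, hξ0⟩).mono_of_mem_nhdsWithin ?_
      exact inter_mem_nhdsWithin _ (isOpen_compl_singleton.mem_nhds hξ0)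
  have hsphere : ∀ ξ ∈ Metric.sphere (0 : ℂ) 1, ξ ≠ 0 := by
    rintro ξ hξ rfl; simp at hξ
  rcases Nat.eq_zero_or_pos k with rfl | hk
  · have hint : (∮ ξ in C(0, 1), ξ ^ 0 * (dχ (p.eval ξ) * p.derivative.eval ξ)) =
        ∮ ξ in C(0, 1), (ξ - 0)⁻¹ • Ψ ξ := by
      refine circleIntegral.integral_congr zero_le_one fun ξ hξ => ?_
      have hξ0 := hsphere ξ hξ
      simp only [hΨ, Function.update_of_ne hξ0, sub_zero, smul_eq_mul, pow_zero, one_mul]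
      field_simp
    rw [hint, Complex.circleIntegral_sub_inv_smul_of_differentiable_on_off_countable
      Set.countable_empty (by simp) hΨcont fun ξ hξ => hΨdiff ξ hξ.1]
    simp [hΨ]
  · have hint : (∮ ξ in C(0, 1), ξ ^ k * (dχ (p.eval ξ) * p.derivative.eval ξ)) =
        ∮ ξ in C(0, 1), ξ ^ (k - 1) * Ψ ξ := by
      refine circleIntegral.integral_congr zero_le_one fun ξ hξ => ?_
      have hξ0 := hsphere ξ hξ
      obtain ⟨m, rfl⟩ := Nat.exists_eq_add_of_le' hk
      simp only [hΨ, Function.update_of_ne hξ0, Nat.add_sub_cancel]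
      ring
    rw [hint, if_neg (by omega)]
    exact Complex.circleIntegral_eq_zero_of_differentiable_on_off_countable zero_le_one
      Set.countable_empty ((continuousOn_pow _).mul hΨcont)
      fun ξ hξ => (differentiableAt_pow _).mul (hΨdiff ξ hξ.1)

variable {n : ℕ} {f : ℝ → ℂ[X]}

/-- Passing to polynomial coefficients avoids differentiating under the integral. The 2 is the
factor -2 of the equation times the source residue -1. -/
lemma hasDerivWithinAt_stokesC (hf : IsGlobalStokesSolution n f) {t : ℝ} (ht : 0 ≤ t) {k : ℕ}
    (hk : k < n) :
    HasDerivWithinAt (fun s => stokesC (f s) k) (if k = 0 then 2 else 0) (Set.Ici 0) t := by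
  obtain ⟨dχ, hχ, heq⟩ := hf.equation
  have hsphere : ∀ ξ ∈ Metric.sphere (0 : ℂ) 1, ξ ≠ 0 := by
    rintro ξ hξ rfl; simp at hξ
  obtain ⟨D, hD, hDv⟩ := exists_hasDerivWithinAt_coeff (P := fun s => boundaryPoly n (f s))
    (N := 2 * n) (by omega) (uniqueDiffOn_Ici (0 : ℝ) t ht) ht
    (fun s hs => natDegree_boundaryPoly_lt (by omega) (hf.natDegree_eq s hs).le)
    (v := fun ξ => ξ ^ n * (-2 * (dχ t ((f t).eval ξ) * (f t).derivative.eval ξ))) (by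
      intro ξ hξ
      obtain ⟨v, hv, hv0⟩ := heq t ht ξ hξ
      have hrel : ∀ s ∈ Set.Ici (0 : ℝ), (boundaryPoly n (f s)).eval ξ =
          ξ ^ n * ((f s).derivative.eval ξ * conjFun (f s) (1 / ξ)) := by
        intro s hs
        have hξ0 := hsphere ξ hξ
        rw [derivative_mul_conjFun_eq (hf.natDegree_eq s hs).le hξ0, ← mul_assoc,
          mul_inv_cancel₀ (pow_ne_zero n hξ0), one_mul]
      have hveq : v = -2 * (dχ t ((f t).eval ξ) * (f t).derivative.eval ξ) := by
        linear_combination hv0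
      rw [← hveq]
      exact (hv.const_mul (ξ ^ n)).congr hrel (hrel t ht))
  have hint : (∮ ξ in C(0, 1), ξ ^ k * ((ξ ^ n)⁻¹ * D.eval ξ)) =
      ∮ ξ in C(0, 1), -2 * (ξ ^ k * (dχ t ((f t).eval ξ) * (f t).derivative.eval ξ)) := by
    refine circleIntegral.integral_congr zero_le_one fun ξ hξ => ?_
    have hξ0 := hsphere ξ hξ
    simp only [hDv ξ hξ]
    field_simp
  rw [circleIntegral_pow_mul_inv_pow_mul_eval hk, circleIntegral.integral_const_mul,
    circleIntegral_pow_mul_source (hf.eval_zero t ht) (hf.univalent t ht) (hχ t ht)] at hint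
  have hval : D.coeff (n - 1 - k) = if k = 0 then 2 else 0 := by
    refine mul_left_cancel₀ Complex.two_pi_I_ne_zero (hint.trans ?_)
    split_ifs <;> ring
  rw [← hval]
  exact (hD (n - 1 - k)).congr
    (fun s hs => stokesC_eq_coeff hk (hf.natDegree_eq s hs).le)
    (stokesC_eq_coeff hk (hf.natDegree_eq t ht).le)

lemma stokesC_eq_add (hf : IsGlobalStokesSolution n f) {t : ℝ} (ht : 0 ≤ t) {k : ℕ} (hk : k < n) :
    stokesC (f t) k = stokesC (f 0) k + if k = 0 then ((2 * t : ℝ) : ℂ) else 0 := by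
  have hder : ∀ s ∈ Set.Ici (0 : ℝ), HasDerivWithinAt
      (fun s : ℝ => stokesC (f s) k - if k = 0 then ((2 * s : ℝ) : ℂ) else 0) 0 (Set.Ici 0) s := by
    intro s hs
    have h1 := hasDerivWithinAt_stokesC hf hs hk
    split_ifs with h0
    · have h2 : HasDerivWithinAt (fun s : ℝ => ((2 * s : ℝ) : ℂ)) ((2 * 1 : ℝ) : ℂ) (Set.Ici 0) s :=
        ((hasDerivAt_id s).const_mul 2).ofReal_comp.hasDerivWithinAt
      have h3 := h1.fun_sub h2
      simpa [h0] using h3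
    · simpa [h0] using h1
  have h := (convex_Ici (0 : ℝ)).norm_image_sub_le_of_norm_hasDerivWithin_le (C := 0) hder
    (by simp) (show (0 : ℝ) ∈ Set.Ici 0 by simp) ht
  rw [zero_mul, norm_le_zero_iff] at h
  have h0 : (if k = 0 then ((2 * (0 : ℝ) : ℝ) : ℂ) else 0) = 0 := by simp
  rw [h0] at h
  linear_combination h

/-! ### Asymptotics of the algebraic system -/

/-- The algebraic system satisfied by the coefficients `A = a₁` and `a i`, `2 ≤ i ≤ n`, of a global
polynomial solution with conserved moments `c k` and initial area `c₀`. -/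
structure MomentSystem (n : ℕ) (A : ℝ → ℝ) (a : ℕ → ℝ → ℂ) (c : ℕ → ℂ) (c₀ K : ℝ) : Prop where
  pos : ∀ t, 0 ≤ t → 0 < A t
  norm_le : ∀ i ∈ Finset.Icc 2 n, ∀ t, 0 ≤ t → ‖a i t‖ ≤ K * A t
  area : ∀ t, 0 ≤ t → 2 * t + c₀ = A t ^ 2 + ∑ i ∈ Finset.Icc 2 n, (i : ℝ) * ‖a i t‖ ^ 2
  moment : ∀ k, 2 ≤ k → k ≤ n → ∀ t, 0 ≤ t →
    c (k - 1) = A t * conj (a k t) +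
      ∑ i ∈ Finset.Icc 2 (n - k + 1), (i : ℂ) * a i t * conj (a (i + k - 1) t)

namespace MomentSystem

variable {n : ℕ} {A : ℝ → ℝ} {a : ℕ → ℝ → ℂ} {c : ℕ → ℂ} {c₀ K : ℝ}

lemma tendsto_sq_atTop (h : MomentSystem n A a c c₀ K) : Tendsto (fun t => A t ^ 2) atTop atTop := by
  set M : ℝ := 1 + ∑ i ∈ Finset.Icc 2 n, (i : ℝ) * K ^ 2 with hM
  have hMpos : 0 < M := by positivity
  have hle : ∀ᶠ t in atTop, (2 * t + c₀) / M ≤ A t ^ 2 := by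
    filter_upwards [eventually_ge_atTop 0] with t ht
    rw [div_le_iff₀ hMpos, h.area t ht, hM, mul_add, mul_one, Finset.mul_sum]
    refine add_le_add le_rfl (Finset.sum_le_sum fun i hi => ?_)
    have := h.norm_le i hi t ht
    calc (i : ℝ) * ‖a i t‖ ^ 2 ≤ i * (K * A t) ^ 2 := by gcongr
      _ = A t ^ 2 * (i * K ^ 2) := by ring
  refine tendsto_atTop_mono' _ hle ?_
  exact (tendsto_atTop_add_const_right _ _ (tendsto_id.const_mul_atTop two_pos)).atTop_div_const
    hMpos

/-- The moment identity for k involves, besides a_k, only products a_i conj(a_{i+k-1}) with i ≥ 2.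
The second index exceeds k, so A a_{i+k-1} is already bounded, and |a_i| ≤ K A absorbs the other
factor. For k = n the sum is empty. -/
lemma exists_bound (h : MomentSystem n A a c c₀ K) {k : ℕ} (hk : 2 ≤ k) (hkn : k ≤ n) :
    ∃ M : ℝ, ∀ t, 0 ≤ t → ‖(A t : ℂ) * a k t‖ ≤ M := by
  induction hm : n - k using Nat.strong_induction_on generalizing k with
  | _ m ih =>
    have hex : ∀ i ∈ Finset.Icc 2 (n - k + 1), ∃ M : ℝ, ∀ t, 0 ≤ t →
        ‖(A t : ℂ) * a (i + k - 1) t‖ ≤ M := by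
      intro i hi
      rw [Finset.mem_Icc] at hi
      exact ih (n - (i + k - 1)) (by omega) (by omega) (by omega) rfl
    choose! M hM using hex
    refine ⟨‖c (k - 1)‖ + ∑ i ∈ Finset.Icc 2 (n - k + 1), i * (K * M i), fun t ht => ?_⟩
    have hA := h.pos t ht
    have heq : (A t : ℂ) * conj (a k t) = c (k - 1) -
        ∑ i ∈ Finset.Icc 2 (n - k + 1), (i : ℂ) * a i t * conj (a (i + k - 1) t) := by
      rw [h.moment k hk hkn t ht]; ring
    have hnorm : ‖(A t : ℂ) * a k t‖ = ‖(A t : ℂ) * conj (a k t)‖ := by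
      rw [norm_mul, norm_mul, RCLike.norm_conj]
    rw [hnorm, heq]
    refine (norm_sub_le _ _).trans (add_le_add le_rfl ((norm_sum_le _ _).trans ?_))
    refine Finset.sum_le_sum fun i hi => ?_
    have hi' := Finset.mem_Icc.1 hi
    have h1 := h.norm_le i (Finset.mem_Icc.2 (by omega)) t ht
    have h2 := hM i hi t ht
    have hK : 0 ≤ K := nonneg_of_mul_nonneg_left ((norm_nonneg _).trans h1) hA
    rw [norm_mul, Complex.norm_real, Real.norm_of_nonneg hA.le] at h2
    rw [norm_mul, norm_mul, RCLike.norm_conj, Complex.norm_natCast, mul_assoc]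
    refine mul_le_mul_of_nonneg_left ?_ (Nat.cast_nonneg i)
    calc ‖a i t‖ * ‖a (i + k - 1) t‖ ≤ K * A t * ‖a (i + k - 1) t‖ := by gcongr
      _ = K * (A t * ‖a (i + k - 1) t‖) := by ring
      _ ≤ K * M i := by gcongr

lemma tendsto_mul_conj_zero (h : MomentSystem n A a c c₀ K) {i j : ℕ} (hi : i ∈ Finset.Icc 2 n)
    (hj : j ∈ Finset.Icc 2 n) : Tendsto (fun t => a i t * conj (a j t)) atTop (𝓝 0) := by
  obtain ⟨M, hM⟩ := h.exists_bound (Finset.mem_Icc.1 hi).1 (Finset.mem_Icc.1 hi).2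
  obtain ⟨N, hN⟩ := h.exists_bound (Finset.mem_Icc.1 hj).1 (Finset.mem_Icc.1 hj).2
  have hlim : Tendsto (fun t => M * N * (A t ^ 2)⁻¹) atTop (𝓝 0) := by
    simpa using h.tendsto_sq_atTop.inv_tendsto_atTop.const_mul (M * N)
  refine squeeze_zero_norm' ?_ hlim
  filter_upwards [eventually_ge_atTop 0] with t ht
  have hA := h.pos t ht
  have h1 := hM t ht
  have h2 := hN t ht
  rw [norm_mul, Complex.norm_real, Real.norm_of_nonneg hA.le] at h1 h2
  rw [norm_mul, RCLike.norm_conj, ← div_eq_mul_inv, le_div_iff₀ (by positivity)]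
  calc ‖a i t‖ * ‖a j t‖ * A t ^ 2 = (A t * ‖a i t‖) * (A t * ‖a j t‖) := by ring
    _ ≤ M * N := mul_le_mul h1 h2 (by positivity) ((by positivity : 0 ≤ A t * ‖a i t‖).trans h1)

lemma tendsto_mul_conj (h : MomentSystem n A a c c₀ K) {k : ℕ} (hk : k ∈ Finset.Icc 2 n) :
    Tendsto (fun t => (A t : ℂ) * conj (a k t)) atTop (𝓝 (c (k - 1))) := by
  have hk' := Finset.mem_Icc.1 hk
  have hsum : Tendsto (fun t => c (k - 1) - ∑ i ∈ Finset.Icc 2 (n - k + 1),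
      (i : ℂ) * (a i t * conj (a (i + k - 1) t))) atTop
      (𝓝 (c (k - 1) - ∑ i ∈ Finset.Icc 2 (n - k + 1), (i : ℂ) * 0)) := by
    refine tendsto_const_nhds.sub (tendsto_finsetSum _ fun i hi => ?_)
    have hi' := Finset.mem_Icc.1 hi
    exact (h.tendsto_mul_conj_zero (Finset.mem_Icc.2 (by omega))
      (Finset.mem_Icc.2 (by omega))).const_mul _
  simp only [mul_zero, Finset.sum_const_zero, sub_zero] at hsum
  refine hsum.congr' ?_
  filter_upwards [eventually_ge_atTop 0] with t ht
  rw [h.moment k hk'.1 hk'.2 t ht]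
  simp only [mul_assoc]
  ring

lemma tendsto_mul (h : MomentSystem n A a c c₀ K) {k : ℕ} (hk : k ∈ Finset.Icc 2 n) :
    Tendsto (fun t => (A t : ℂ) * a k t) atTop (𝓝 (conj (c (k - 1)))) := by
  have := (Complex.continuous_conj.tendsto _).comp (h.tendsto_mul_conj hk)
  simpa [Function.comp_def] using this

/-- Divide the area identity by A²: the sum tends to 0 and A² → ∞. -/
lemma tendsto_div_sq (h : MomentSystem n A a c c₀ K) :
    Tendsto (fun t => 2 * t / A t ^ 2) atTop (𝓝 1) := by
  have hinv := h.tendsto_sq_atTop.inv_tendsto_atTop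
  have hsum : Tendsto (fun t => ∑ i ∈ Finset.Icc 2 n, (i : ℝ) * ‖a i t‖ ^ 2) atTop (𝓝 0) := by
    have : Tendsto (fun t => ∑ i ∈ Finset.Icc 2 n, (i : ℝ) * ‖a i t * conj (a i t)‖) atTop
        (𝓝 (∑ i ∈ Finset.Icc 2 n, (i : ℝ) * ‖(0 : ℂ)‖)) :=
      tendsto_finsetSum _ fun i hi => ((h.tendsto_mul_conj_zero hi hi).norm).const_mul _
    simpa [pow_two] using this
  have hlim : Tendsto (fun t => 1 + ((∑ i ∈ Finset.Icc 2 n, (i : ℝ) * ‖a i t‖ ^ 2) - c₀) *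
      (A t ^ 2)⁻¹) atTop (𝓝 (1 + (0 - c₀) * 0)) :=
    tendsto_const_nhds.add ((hsum.sub tendsto_const_nhds).mul hinv)
  rw [mul_zero, add_zero] at hlim
  refine hlim.congr' ?_
  filter_upwards [eventually_ge_atTop 0] with t ht
  have hA := (h.pos t ht).ne'
  have := h.area t ht
  field_simp
  linarith

lemma tendsto_mul_conj_mul (h : MomentSystem n A a c c₀ K) {i j : ℕ} (hi : i ∈ Finset.Icc 2 n)
    (hj : j ∈ Finset.Icc 2 n) :
    Tendsto (fun t => a i t * conj (a j t) * ((2 * t : ℝ) : ℂ)) atTop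
      (𝓝 (conj (c (i - 1)) * c (j - 1))) := by
  have hr : Tendsto (fun t => ((2 * t / A t ^ 2 : ℝ) : ℂ)) atTop (𝓝 ((1 : ℝ) : ℂ)) :=
    (Complex.continuous_ofReal.tendsto _).comp h.tendsto_div_sq
  have := ((h.tendsto_mul hi).mul (h.tendsto_mul_conj hj)).mul hr
  rw [Complex.ofReal_one, mul_one] at this
  refine this.congr' ?_
  filter_upwards [eventually_ge_atTop 0] with t ht
  have hA : (A t : ℂ) ≠ 0 := by exact_mod_cast (h.pos t ht).ne'
  push_cast
  field_simp

theorem tendsto_coeff (h : MomentSystem n A a c c₀ K) {k : ℕ} (hk : 2 ≤ k) (hkn : k ≤ n) :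
    Tendsto (fun t => (conj (a k t) * A t - c (k - 1)) * ((2 * t : ℝ) : ℂ)) atTop
      (𝓝 (-∑ j ∈ Finset.Icc 2 (n - k + 1), (j : ℂ) * conj (c (j - 1)) * c (j + k - 2))) := by
  have hlim : Tendsto (fun t => -∑ j ∈ Finset.Icc 2 (n - k + 1),
      (j : ℂ) * (a j t * conj (a (j + k - 1) t) * ((2 * t : ℝ) : ℂ))) atTop
      (𝓝 (-∑ j ∈ Finset.Icc 2 (n - k + 1),
        (j : ℂ) * (conj (c (j - 1)) * c (j + k - 1 - 1)))) := by
    refine (tendsto_finsetSum _ fun j hj => ?_).neg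
    have hj' := Finset.mem_Icc.1 hj
    exact (h.tendsto_mul_conj_mul (Finset.mem_Icc.2 (by omega))
      (Finset.mem_Icc.2 (by omega))).const_mul _
  simp only [Nat.sub_sub, ← mul_assoc] at hlim
  refine hlim.congr' ?_
  filter_upwards [eventually_ge_atTop 0] with t ht
  rw [h.moment k hk hkn t ht, ← Finset.sum_mul]
  ring

lemma tendsto_sqrt_div_add_sqrt (h : MomentSystem n A a c c₀ K) :
    Tendsto (fun t => √(2 * t) / (A t + √(2 * t + c₀))) atTop (𝓝 (1 / 2)) := by
  have hA : Tendsto (fun t => √((2 * t / A t ^ 2)⁻¹)) atTop (𝓝 1) := by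
    have := (Real.continuous_sqrt.tendsto _).comp (h.tendsto_div_sq.inv₀ one_ne_zero)
    simpa [Function.comp_def] using this
  have hc : Tendsto (fun t : ℝ => √(1 + c₀ * (2 * t)⁻¹)) atTop (𝓝 1) := by
    have h1 : Tendsto (fun t : ℝ => (2 * t)⁻¹) atTop (𝓝 0) :=
      (tendsto_id.const_mul_atTop two_pos).inv_tendsto_atTop
    have h2 : Tendsto (fun t : ℝ => 1 + c₀ * (2 * t)⁻¹) atTop (𝓝 (1 + c₀ * 0)) :=
      tendsto_const_nhds.add (h1.const_mul c₀)
    have := (Real.continuous_sqrt.tendsto _).comp h2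
    simpa [Function.comp_def] using this
  have hlim := (hA.add hc).inv₀ (by norm_num)
  rw [show ((1 : ℝ) + 1)⁻¹ = 1 / 2 by norm_num] at hlim
  refine hlim.congr' ?_
  filter_upwards [eventually_gt_atTop 0] with t ht
  have hApos := h.pos t ht.le
  have hs : 0 < √(2 * t) := by positivity
  have e1 : √((2 * t / A t ^ 2)⁻¹) = A t / √(2 * t) := by
    rw [inv_div, Real.sqrt_div (by positivity), Real.sqrt_sq hApos.le]
  have e2 : √(1 + c₀ * (2 * t)⁻¹) = √(2 * t + c₀) / √(2 * t) := by
    rw [← Real.sqrt_div' _ (by positivity)]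
    congr 1
    field_simp
  rw [e1, e2, ← add_div, inv_div]

/-- A - √(2t + c₀) = -(∑ i|a_i|²) / (A + √(2t + c₀)) by the area identity. Of the factor (2t)^(3/2),
2t goes to the sum and √(2t) to the quotient, whose limit is 1/2. -/
theorem tendsto_leading (h : MomentSystem n A a c c₀ K) :
    Tendsto (fun t => (A t - √(2 * t + c₀)) * (2 * t) ^ (3 / 2 : ℝ)) atTop
      (𝓝 (-(1 / 2) * ∑ k ∈ Finset.Icc 2 n, (k : ℝ) * ‖c (k - 1)‖ ^ 2)) := by
  have hsum : Tendsto (fun t => ∑ i ∈ Finset.Icc 2 n,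
      (i : ℝ) * ‖a i t * conj (a i t) * ((2 * t : ℝ) : ℂ)‖) atTop
      (𝓝 (∑ i ∈ Finset.Icc 2 n, (i : ℝ) * ‖conj (c (i - 1)) * c (i - 1)‖)) :=
    tendsto_finsetSum _ fun i hi => ((h.tendsto_mul_conj_mul hi hi).norm).const_mul _
  have hlim := (hsum.mul h.tendsto_sqrt_div_add_sqrt).neg
  have hval : -((∑ i ∈ Finset.Icc 2 n, (i : ℝ) * ‖conj (c (i - 1)) * c (i - 1)‖) * (1 / 2)) =
      -(1 / 2) * ∑ k ∈ Finset.Icc 2 n, (k : ℝ) * ‖c (k - 1)‖ ^ 2 := by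
    simp only [norm_mul, RCLike.norm_conj, ← pow_two]
    ring
  rw [hval] at hlim
  refine hlim.congr' ?_
  filter_upwards [eventually_gt_atTop 0] with t ht
  have hApos := h.pos t ht.le
  have harea := h.area t ht.le
  have hS : ∑ i ∈ Finset.Icc 2 n, (i : ℝ) * ‖a i t * conj (a i t) * ((2 * t : ℝ) : ℂ)‖ =
      (2 * t + c₀ - A t ^ 2) * (2 * t) := by
    rw [harea, add_sub_cancel_left, Finset.sum_mul]
    refine Finset.sum_congr rfl fun i _ => ?_
    rw [norm_mul, norm_mul, RCLike.norm_conj, Complex.norm_real,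
      Real.norm_of_nonneg (by positivity)]
    ring
  have hnonneg : 0 ≤ 2 * t + c₀ := by rw [harea]; positivity
  have hsq := Real.sq_sqrt hnonneg
  have hden : A t + √(2 * t + c₀) ≠ 0 := by positivity
  have hpow : (2 * t) ^ (3 / 2 : ℝ) = 2 * t * √(2 * t) := by
    rw [Real.sqrt_eq_rpow, ← Real.rpow_one_add' (by positivity) (by norm_num)]
    norm_num
  rw [hS, hpow]
  field_simp
  linear_combination hsq

end MomentSystem

/-! ### Stokes solutions satisfy the algebraic system -/

lemma coeff_one_eq_re (hf : IsGlobalStokesSolution n f) {t : ℝ} (ht : 0 ≤ t) :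
    (f t).coeff 1 = (((f t).coeff 1).re : ℂ) := by
  have h := hf.deriv_zero_im t ht
  rw [← coeff_zero_eq_eval_zero, coeff_derivative] at h
  exact Complex.ext (by simp) (by simpa using h)

lemma momentSystem (hn : 2 ≤ n) (hf : IsGlobalStokesSolution n f) :
    MomentSystem n (fun t => ((f t).coeff 1).re) (fun k t => (f t).coeff k)
      (fun k => stokesC (f 0) k) (stokesC (f 0) 0).re (2 ^ n) := by
  have hpos : ∀ t, 0 ≤ t → 0 < ((f t).coeff 1).re := by
    intro t ht
    have h := hf.deriv_zero_pos t ht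
    rw [← coeff_zero_eq_eval_zero, coeff_derivative] at h
    simpa using h
  -- The i = 1 term is the one carrying a_1: it becomes A² in the area identity and A conj(a_k) in
  -- the moments.
  have hsplit : ∀ m, 1 ≤ m → Finset.Icc 1 m = insert 1 (Finset.Icc 2 m) := by
    intro m hm
    ext i
    simp only [Finset.mem_Icc, Finset.mem_insert]
    omega
  refine ⟨hpos, fun i hi t ht => ?_, fun t ht => ?_, fun k hk hkn t ht => ?_⟩
  · have h := norm_coeff_le_of_injOn (hf.univalent t ht) (k := i)
      (by have := Finset.mem_Icc.1 hi; omega)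
    rw [hf.natDegree_eq t ht, coeff_one_eq_re hf ht, Complex.norm_real,
      Real.norm_of_nonneg (hpos t ht).le] at h
    exact h
  · have h := stokesC_eq_add hf ht (k := 0) (by omega)
    rw [stokesC_eq_sum (n := n) (by omega) (hf.natDegree_eq t ht).le, Nat.sub_zero,
      hsplit n (by omega), Finset.sum_insert (by simp)] at h
    have h' := congrArg Complex.re h
    have hterm : ∀ i : ℕ, ((i : ℂ) * (f t).coeff i * conj ((f t).coeff (i + 0))).re =
        (i : ℝ) * ‖(f t).coeff i‖ ^ 2 := by
      intro i
      rw [add_zero, mul_assoc, Complex.mul_conj, Complex.normSq_eq_norm_sq,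
        ← Complex.ofReal_natCast, ← Complex.ofReal_mul, Complex.ofReal_re]
    rw [Complex.add_re, Complex.re_sum, Finset.sum_congr rfl fun i _ => hterm i, hterm 1,
      coeff_one_eq_re hf ht, Complex.norm_real, Real.norm_eq_abs, sq_abs] at h'
    simp only [Nat.cast_one, one_mul, if_true, Complex.add_re, Complex.ofReal_re] at h'
    linarith
  · have h := stokesC_eq_add hf ht (k := k - 1) (by omega)
    rw [stokesC_eq_sum (n := n) (by omega) (hf.natDegree_eq t ht).le,
      hsplit _ (by omega), Finset.sum_insert (by simp), if_neg (by omega), add_zero] at h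
    rw [← h, show n - (k - 1) = n - k + 1 by omega, show 1 + (k - 1) = k by omega,
      ← coeff_one_eq_re hf ht, Nat.cast_one, one_mul]
    congr 1
    refine Finset.sum_congr rfl fun i _ => ?_
    rw [Nat.add_sub_assoc (by omega)]

end StokesFlow

open StokesFlow in
theorem mainTheorem7 (n : ℕ) (hn : 2 ≤ n) (f : ℝ → ℂ[X]) (hf : IsGlobalStokesSolution n f) :
    (∀ k : ℕ, 2 ≤ k → k ≤ n →
      Tendsto
        (fun t : ℝ =>
          (conj ((f t).coeff k) * (f t).coeff 1 - stokesC (f 0) (k - 1)) * ((2 * t : ℝ) : ℂ))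
        atTop
        (𝓝 (-∑ j ∈ Finset.Icc 2 (n - k + 1),
          (j : ℂ) * conj (stokesC (f 0) (j - 1)) * stokesC (f 0) (j + k - 2)))) ∧
    Tendsto
      (fun t : ℝ =>
        ((f t).coeff 1 - (Real.sqrt (2 * t + (stokesC (f 0) 0).re) : ℂ)) *
          (((2 * t) ^ (3 / 2 : ℝ) : ℝ) : ℂ))
      atTop
      (𝓝 ((-(1 / 2) * ∑ k ∈ Finset.Icc 2 n, (k : ℝ) * ‖stokesC (f 0) (k - 1)‖ ^ 2 : ℝ) : ℂ)) := by
  have h := momentSystem hn hf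
  refine ⟨fun k hk hkn => (h.tendsto_coeff hk hkn).congr' ?_,
    ((Complex.continuous_ofReal.tendsto _).comp h.tendsto_leading).congr' ?_⟩
  · filter_upwards [eventually_ge_atTop 0] with t ht
    rw [← coeff_one_eq_re hf ht]
  · filter_upwards [eventually_ge_atTop 0] with t ht
    rw [coeff_one_eq_re hf ht]
    simp
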